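/- All Lie algebras are over $\mathbb{C}$ and finite-dimensional. For Lie algebras $\mathfrak{l},\mathfrak{k}$ let $\mathrm{rep}(\mathfrak{l},\mathfrak{k})\subseteq \mathrm{Hom}_{\mathbb{C}}(\mathfrak{l},\mathfrak{k})$ be the affine variety (Zariski closed subset) of all Lie algebra homomorphisms $\mathfrak{l}\to\mathfrak{k}$, with base point $0$, and let $\mathrm{rep}(\mathfrak{l},\mathfrak{k})_{(0)}$ be its complex analytic germ at $0$. (A morphism of germs $(X,x)\to(Y,y)$ between subsets of finite-dimensional complex vector spaces is the germ at $x$ of a map $X\to Y$, sending $x$ to $y$, that near $x$ is the restriction of an analytic map between the ambient spaces; an isomorphism is such a morphism with a two-sided inverse morphism.) Let $\mathfrak{h}=\mathfrak{s}\rtimes_{\alpha}\mathfrak{g}$ be a Levi decomposition of a Lie algebra $\mathfrak{h}$, with $\mathfrak{s}$ solvable, $\mathfrak{g}$ semisimple, and $\alpha\colon\mathfrak{g}\to\mathrm{Der}(\mathfrak{s})$ a Lie homomorphism. Let $\widetilde{\mathfrak{s}}$ be the quotient of $\mathfrak{s}$ by the Lie ideal generated by the elements $\alpha(y)x$, for $x\in\mathfrak{s}$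 and $y\in\mathfrak{g}$, and let $q\colon\mathfrak{s}\to\widetilde{\mathfrak{s}}$ be the quotient map. For a Lie algebra $\mathfrak{k}$, let $$Q\colon \mathrm{rep}(\widetilde{\mathfrak{s}},\mathfrak{k})\longrightarrow \mathrm{rep}(\mathfrak{h},\mathfrak{k})$$ send $\widetilde{\Phi}$ to the homomorphism whose restriction to $\mathfrak{s}$ is $\widetilde{\Phi}\circ q$ and whose restriction to $\mathfrak{g}$ is $0$. Then, for every Levi decomposition as above and every Lie algebra $\mathfrak{k}$, the map $Q$ induces an isomorphism of analytic germs $\mathrm{rep}(\widetilde{\mathfrak{s}},\mathfrak{k})_{(0)}\simeq \mathrm{rep}(\mathfrak{h},\mathfrak{k})_{(0)}$. -/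

import Mathlib

open Filter Topology

noncomputable section

namespace LieRepGerm

/-! ### Complex analytic germs of subsets of finite-dimensional complex vector spaces

The spaces carry no chosen norm; topology and analyticity are read off in linear coordinates.
`nhdsAt_eq_comap` and `holomorphicAt_iff` show that the choice of coordinates is irrelevant. -/

section Germs

variable {E F : Type*} [AddCommGroup E] [Module ℂ E] [FiniteDimensional ℂ E]
  [AddCommGroup F] [Module ℂ F] [FiniteDimensional ℂ F]

/-- Linear coordinates on a finite-dimensional complex vector space. -/
def coord (E : Type*) [AddCommGroup E] [Module ℂ E] [FiniteDimensional ℂ E] :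
    E ≃ₗ[ℂ] (Fin (Module.finrank ℂ E) → ℂ) :=
  (Module.finBasis ℂ E).equivFun

/-- The filter of neighbourhoods of `x` in `E`, for the usual topology. -/
def nhdsAt (x : E) : Filter E := comap (coord E) (𝓝 (coord E x))

/-- `f` is (complex) analytic in a neighbourhood of `x`. -/
def HolomorphicAt (f : E → F) (x : E) : Prop :=
  AnalyticAt ℂ (fun v => coord F (f ((coord E).symm v))) (coord E x)

/-- The neighbourhood filter can be computed through any linear isomorphism to a normed space. -/
theorem nhdsAt_eq_comap {V : Type*} [NormedAddCommGroup V] [NormedSpace ℂ V] (c : E ≃ₗ[ℂ] V)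
    (x : E) : nhdsAt x = comap c (𝓝 (c x)) := by
  let d : (Fin (Module.finrank ℂ E) → ℂ) ≃L[ℂ] V :=
    ((coord E).symm.trans c).toContinuousLinearEquiv
  have h : (c : E → V) = d ∘ coord E := by
    funext z; simp [d]
  have h2 : c x = d (coord E x) := congrFun h x
  rw [h2, h, ← comap_comap, nhdsAt]
  congr 1
  exact d.toHomeomorph.isInducing.nhds_eq_comap _

/-- Analyticity can be tested through any linear isomorphisms to normed spaces. -/
theorem holomorphicAt_iff {V W : Type*} [NormedAddCommGroup V] [NormedSpace ℂ V]
    [NormedAddCommGroup W] [NormedSpace ℂ W] (c : E ≃ₗ[ℂ] V) (d : F ≃ₗ[ℂ] W)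
    (f : E → F) (x : E) :
    HolomorphicAt f x ↔ AnalyticAt ℂ (fun v => d (f (c.symm v))) (c x) := by
  let a : (Fin (Module.finrank ℂ E) → ℂ) ≃L[ℂ] V :=
    ((coord E).symm.trans c).toContinuousLinearEquiv
  let b : (Fin (Module.finrank ℂ F) → ℂ) ≃L[ℂ] W :=
    ((coord F).symm.trans d).toContinuousLinearEquiv
  constructor
  · intro h
    have h1 : AnalyticAt ℂ (fun v : V => a.symm v) (c x) := a.symm.analyticAt _
    have e1 : a.symm (c x) = coord E x := by simp [a]
    have h2 := AnalyticAt.fun_comp (g := fun v => coord F (f ((coord E).symm v)))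
      (by rw [e1]; exact h) h1
    refine ((b.analyticAt _).fun_comp h2).congr (Eventually.of_forall fun v => ?_)
    simp [a, b]
  · intro h
    have h1 : AnalyticAt ℂ (fun v => a v) (coord E x) := a.analyticAt _
    have e1 : a (coord E x) = c x := by simp [a]
    have h2 := AnalyticAt.fun_comp (g := fun v => d (f (c.symm v))) (by rw [e1]; exact h) h1
    refine ((b.symm.analyticAt _).fun_comp h2).congr (Eventually.of_forall fun v => ?_)
    simp [a, b]

/-- The filter of neighbourhoods of the point `x` in the subset `X ⊆ E`. -/
def nhdsOn {X : Set E} (x : X) : Filter X := comap Subtype.val (nhdsAt (x : E))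

/-- Near `x`, the map `f` from `X ⊆ E` to `Y ⊆ F` is the restriction of an analytic map between
the ambient spaces; so `f` represents a morphism of analytic germs `(X, x) → (Y, f x)`. -/
def IsAnalyticGermMap {X : Set E} {Y : Set F} (f : X → Y) (x : X) : Prop :=
  ∃ f' : E → F, HolomorphicAt f' (x : E) ∧ ∀ᶠ z : X in nhdsOn x, f' (z : E) = (f z : F)

/-- `f` induces an isomorphism of analytic germs `(X, x) ≃ (Y, y)`: it represents a morphism of
germs which has a two-sided inverse morphism of germs. -/
def InducesGermIso {X : Set E} {Y : Set F} (f : X → Y) (x : X) (y : Y) : Prop :=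
  f x = y ∧ IsAnalyticGermMap f x ∧
    ∃ g : Y → X, g y = x ∧ IsAnalyticGermMap g y ∧
      (∀ᶠ z in nhdsOn x, g (f z) = z) ∧ (∀ᶠ w in nhdsOn y, f (g w) = w)

end Germs

/-! ### Representation varieties -/

section Rep

variable (L K : Type*) [LieRing L] [LieAlgebra ℂ L] [LieRing K] [LieAlgebra ℂ K]

/-- The variety `rep(L, K)` of Lie algebra homomorphisms, as a subset of the vector space
`Hom(L, K)` of linear maps. -/
def rep : Set (L →ₗ[ℂ] K) := {φ | ∀ x y : L, φ ⁅x, y⁆ = ⁅φ x, φ y⁆}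

/-- The base point of `rep(L, K)`. -/
def zeroRep : rep L K := ⟨0, fun _ _ => by simp⟩

end Rep

section Levi

variable {s g h : Type*} [LieRing s] [LieAlgebra ℂ s] [LieRing g] [LieAlgebra ℂ g]
  [LieRing h] [LieAlgebra ℂ h]

/-- The Lie ideal of `s` generated by all the elements `α(y) x`, for `x ∈ s` and `y ∈ g`. -/
def actionIdeal (α : g →ₗ⁅ℂ⁆ LieDerivation ℂ s s) : LieIdeal ℂ s :=
  LieSubmodule.lieSpan ℂ s {z | ∃ (y : g) (x : s), z = α y x}

/-- The Lie algebra `s / (g · s)`. -/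
abbrev STilde (α : g →ₗ⁅ℂ⁆ LieDerivation ℂ s s) : Type _ := s ⧸ actionIdeal α

/-- The quotient map `q : s → s / (g · s)`. -/
def quotMap (α : g →ₗ⁅ℂ⁆ LieDerivation ℂ s s) : s →ₗ[ℂ] STilde α :=
  (LieSubmodule.Quotient.mk' (actionIdeal α) : s →ₗ[ℂ] STilde α)

theorem quotMap_lie (α : g →ₗ⁅ℂ⁆ LieDerivation ℂ s s) (x y : s) :
    quotMap α ⁅x, y⁆ = ⁅quotMap α x, quotMap α y⁆ :=
  rfl

theorem quotMap_action (α : g →ₗ⁅ℂ⁆ LieDerivation ℂ s s) (y : g) (x : s) :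
    quotMap α (α y x) = 0 :=
  (LieSubmodule.Quotient.mk_eq_zero (N := actionIdeal α)).2 (LieSubmodule.subset_lieSpan ⟨y, x, rfl⟩)

/-- The map `Q : rep(s / (g · s), k) → rep(h, k)`, where `h` is identified with `s ⋊ g` by `e`:
`Q Φ` is the homomorphism with restriction `Φ ∘ q` to `s` and `0` to `g`. -/
def mapQ (α : g →ₗ⁅ℂ⁆ LieDerivation ℂ s s) (e : (s ⋊⁅α⁆ g) ≃ₗ⁅ℂ⁆ h)
    (k : Type*) [LieRing k] [LieAlgebra ℂ k] (Φ : rep (STilde α) k) : rep h k :=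
  ⟨(Φ : STilde α →ₗ[ℂ] k) ∘ₗ quotMap α ∘ₗ LieAlgebra.SemiDirectSum.projl α ∘ₗ
      (e.symm.toLinearEquiv : h →ₗ[ℂ] (s ⋊⁅α⁆ g)), fun x y => by
    have hx := Φ.2
    simp only [rep, Set.mem_ofPred_eq] at hx
    simp [LieEquiv.map_lie, quotMap_lie, quotMap_action, hx]⟩

theorem mapQ_inl (α : g →ₗ⁅ℂ⁆ LieDerivation ℂ s s) (e : (s ⋊⁅α⁆ g) ≃ₗ⁅ℂ⁆ h)
    (k : Type*) [LieRing k] [LieAlgebra ℂ k] (Φ : rep (STilde α) k) (x : s) :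
    (mapQ α e k Φ : h →ₗ[ℂ] k) (e (LieAlgebra.SemiDirectSum.inl α x)) =
      (Φ : STilde α →ₗ[ℂ] k) (quotMap α x) := by
  simp [mapQ]

theorem mapQ_inr (α : g →ₗ⁅ℂ⁆ LieDerivation ℂ s s) (e : (s ⋊⁅α⁆ g) ≃ₗ⁅ℂ⁆ h)
    (k : Type*) [LieRing k] [LieAlgebra ℂ k] (Φ : rep (STilde α) k) (y : g) :
    (mapQ α e k Φ : h →ₗ[ℂ] k) (e (LieAlgebra.SemiDirectSum.inr α y)) = 0 := by
  simp [mapQ]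

end Levi

end LieRepGerm

end

/-! A semisimple `g` is perfect, and on a perfect algebra a homomorphism `φ` is bounded by a
constant times `‖φ‖ ^ 2`, so `0` is isolated in `rep g k` (`exists_forall_rep_eq_zero`). Restriction
to `g` is continuous, so every homomorphism `h → k` close to `0` vanishes on `g`
(`eventually_restrictRight_eq_zero`). It then kills each `α y x = ⁅y, x⁆` and factors through
`STilde α` (`map_inl_eq_of_quotMap_eq`).

Both directions of the germ isomorphism come from linear maps between the ambient Hom spaces, so
analyticity is immediate: `mapQ` is a precomposition, and its inverse near `0` is precomposition
with a linear section `σ` of `quotMap α`. -/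

namespace LieRepGerm

/-! ### Linear maps as morphisms of germs -/

section Germs

variable {E F : Type*} [AddCommGroup E] [Module ℂ E] [FiniteDimensional ℂ E]
  [AddCommGroup F] [Module ℂ F] [FiniteDimensional ℂ F]

theorem holomorphicAt_linearMap (f : E →ₗ[ℂ] F) (x : E) : HolomorphicAt f x := by
  let a := LinearMap.toContinuousLinearMap
    ((coord F).toLinearMap ∘ₗ f ∘ₗ (coord E).symm.toLinearMap)
  exact a.analyticAt _

theorem tendsto_linearMap_nhdsAt {V : Type*} [NormedAddCommGroup V] [NormedSpace ℂ V]
    (f : E →ₗ[ℂ] V) (x : E) : Tendsto f (nhdsAt x) (𝓝 (f x)) := by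
  have h : Continuous (f ∘ₗ (coord E).symm.toLinearMap) :=
    LinearMap.continuous_of_finiteDimensional _
  have h1 : Tendsto (coord E) (nhdsAt x) (𝓝 (coord E x)) := tendsto_comap
  have h2 := (h.tendsto (coord E x)).comp h1
  simpa [Function.comp_def] using h2

theorem isAnalyticGermMap_of_linearMap {X : Set E} {Y : Set F} {f : X → Y} {x : X}
    (f' : E →ₗ[ℂ] F) (h : ∀ᶠ z : X in nhdsOn x, f' (z : E) = (f z : F)) :
    IsAnalyticGermMap f x :=
  ⟨f', holomorphicAt_linearMap f' x, h⟩

end Germs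

/-! ### Semisimple Lie algebras are perfect -/

section Perfect

theorem lie_top_top_of_isSemisimple (R L : Type*) [CommRing R] [LieRing L] [LieAlgebra R L]
    [LieAlgebra.IsSemisimple R L] : ⁅(⊤ : LieIdeal R L), (⊤ : LieIdeal R L)⁆ = ⊤ := by
  rw [eq_top_iff, ← LieAlgebra.IsSemisimple.sSup_atoms_eq_top (R := R) (L := L)]
  refine sSup_le fun I hI => ?_
  have hI : IsAtom I := hI
  -- The earlier rewrite also hit the `⊤`s inside the bracket; this restores them.
  rw [LieAlgebra.IsSemisimple.sSup_atoms_eq_top]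
  rcases hI.le_iff.1 (LieSubmodule.lie_le_right I I) with h | h
  · refine absurd ?_ (LieAlgebra.IsSemisimple.non_abelian_of_isAtom I hI)
    refine ⟨fun x y => Subtype.ext ?_⟩
    have := LieSubmodule.lie_coe_mem_lie x y
    rw [h] at this
    simpa using this
  · calc I = ⁅I, I⁆ := h.symm
      _ ≤ ⁅⊤, ⊤⁆ := LieSubmodule.mono_lie le_top le_top

theorem span_lie_eq_top_of_isSemisimple (R L : Type*) [CommRing R] [LieRing L] [LieAlgebra R L]
    [LieAlgebra.IsSemisimple R L] : Submodule.span R {z | ∃ x y : L, ⁅x, y⁆ = z} = ⊤ := by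
  have h := LieSubmodule.lieIdeal_oper_eq_linear_span' (R := R) (⊤ : LieIdeal R L)
    (⊤ : LieIdeal R L)
  rw [lie_top_top_of_isSemisimple] at h
  simpa using h.symm

end Perfect

/-! ### The trivial representation of a perfect algebra is isolated -/

section Isolated

variable {g k : Type*} [LieRing g] [LieAlgebra ℂ g] [FiniteDimensional ℂ g]
  [LieRing k] [LieAlgebra ℂ k] [FiniteDimensional ℂ k]

/-- The matrix of a linear map, in linear coordinates. -/
noncomputable def matrixCoord (g k : Type*) [AddCommGroup g] [Module ℂ g] [FiniteDimensional ℂ g]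
    [AddCommGroup k] [Module ℂ k] [FiniteDimensional ℂ k] :
    (g →ₗ[ℂ] k) →ₗ[ℂ] (Fin (Module.finrank ℂ g) → Fin (Module.finrank ℂ k) → ℂ) :=
  LinearMap.pi fun i => (coord k).toLinearMap ∘ₗ LinearMap.applyₗ (Module.finBasis ℂ g i)

theorem matrixCoord_apply (φ : g →ₗ[ℂ] k) (i : Fin (Module.finrank ℂ g)) :
    matrixCoord g k φ i = coord k (φ (Module.finBasis ℂ g i)) := rfl

theorem exists_norm_coord_lie_le (k : Type*) [LieRing k] [LieAlgebra ℂ k]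
    [FiniteDimensional ℂ k] :
    ∃ C : ℝ, 0 ≤ C ∧ ∀ x y : k, ‖coord k ⁅x, y⁆‖ ≤ C * ‖coord k x‖ * ‖coord k y‖ := by
  let V := Fin (Module.finrank ℂ k) → ℂ
  let B : V →ₗ[ℂ] V →ₗ[ℂ] V := LinearMap.mk₂ ℂ
    (fun v w => coord k ⁅(coord k).symm v, (coord k).symm w⁆)
    (by simp) (by simp) (by simp) (by simp)
  let B' : V →L[ℂ] V →L[ℂ] V := LinearMap.toContinuousLinearMap
    ((LinearMap.toContinuousLinearMap : (V →ₗ[ℂ] V) ≃ₗ[ℂ] (V →L[ℂ] V)).toLinearMap ∘ₗ B)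
  refine ⟨‖B'‖, B'.opNorm_nonneg, fun x y => ?_⟩
  simpa [B', B] using B'.le_opNorm₂ (coord k x) (coord k y)

theorem exists_norm_coord_apply_le (x : g) :
    ∃ D : ℝ, 0 ≤ D ∧ ∀ φ : g →ₗ[ℂ] k, ‖coord k (φ x)‖ ≤ D * ‖matrixCoord g k φ‖ := by
  refine ⟨∑ i, ‖(Module.finBasis ℂ g).repr x i‖, by positivity, fun φ => ?_⟩
  conv_lhs => rw [← (Module.finBasis ℂ g).sum_repr x]
  simp only [map_sum, map_smul]
  rw [Finset.sum_mul]
  refine norm_sum_le_of_le _ fun i _ => ?_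
  rw [norm_smul, ← matrixCoord_apply]
  gcongr
  exact norm_le_pi_norm (matrixCoord g k φ) i

/-- On a bracket, `φ ⁅x, y⁆ = ⁅φ x, φ y⁆` is quadratic in `φ`; perfectness spreads the bound to all
`z` by linearity. The constant depends on `z` but not on `φ`. -/
theorem exists_norm_coord_apply_le_sq
    (hg : Submodule.span ℂ {z | ∃ x y : g, ⁅x, y⁆ = z} = ⊤) (z : g) :
    ∃ C : ℝ, 0 ≤ C ∧ ∀ φ ∈ rep g k, ‖coord k (φ z)‖ ≤ C * ‖matrixCoord g k φ‖ ^ 2 := by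
  have hz : z ∈ Submodule.span ℂ {z | ∃ x y : g, ⁅x, y⁆ = z} := hg ▸ Submodule.mem_top
  induction hz using Submodule.span_induction with
  | mem z hz =>
    obtain ⟨x, y, rfl⟩ := hz
    obtain ⟨C, hC, hB⟩ := exists_norm_coord_lie_le k
    obtain ⟨D, hD, hx⟩ := exists_norm_coord_apply_le (k := k) x
    obtain ⟨D', hD', hy⟩ := exists_norm_coord_apply_le (k := k) y
    refine ⟨C * D * D', by positivity, fun φ hφ => ?_⟩
    calc ‖coord k (φ ⁅x, y⁆)‖ = ‖coord k ⁅φ x, φ y⁆‖ := by rw [hφ x y]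
      _ ≤ C * ‖coord k (φ x)‖ * ‖coord k (φ y)‖ := hB _ _
      _ ≤ C * (D * ‖matrixCoord g k φ‖) * (D' * ‖matrixCoord g k φ‖) := by
        gcongr
        · exact hx φ
        · exact hy φ
      _ = C * D * D' * ‖matrixCoord g k φ‖ ^ 2 := by ring
  | zero => exact ⟨0, le_rfl, fun φ _ => by simp⟩
  | add x y _ _ hx hy =>
    obtain ⟨C, hC, hx⟩ := hx
    obtain ⟨C', hC', hy⟩ := hy
    refine ⟨C + C', by positivity, fun φ hφ => ?_⟩
    rw [map_add, map_add, add_mul]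
    exact norm_add_le_of_le (hx φ hφ) (hy φ hφ)
  | smul t x _ hx =>
    obtain ⟨C, hC, hx⟩ := hx
    refine ⟨‖t‖ * C, by positivity, fun φ hφ => ?_⟩
    rw [map_smul, map_smul, norm_smul, mul_assoc]
    gcongr
    exact hx φ hφ

/-- If `g` is perfect, then `0` is an isolated point of `rep(g, k)`: a homomorphism `φ` satisfies
a bound `‖φ‖ ≤ C ‖φ‖ ^ 2`. -/
theorem exists_forall_rep_eq_zero
    (hg : Submodule.span ℂ {z | ∃ x y : g, ⁅x, y⁆ = z} = ⊤) :
    ∃ δ : ℝ, 0 < δ ∧ ∀ φ ∈ rep g k, ‖matrixCoord g k φ‖ < δ → φ = 0 := by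
  choose C hC h using exists_norm_coord_apply_le_sq (k := k) hg
  have hS : 0 ≤ ∑ i, C (Module.finBasis ℂ g i) := Finset.sum_nonneg fun i _ => hC _
  -- The summand `1` keeps the radius positive when all the constants vanish, and makes the final
  -- inequality strict.
  refine ⟨(1 + ∑ i, C (Module.finBasis ℂ g i))⁻¹, by positivity, fun φ hφ hlt => ?_⟩
  have hle : ‖matrixCoord g k φ‖ ≤
      (∑ i, C (Module.finBasis ℂ g i)) * ‖matrixCoord g k φ‖ ^ 2 := by
    refine (pi_norm_le_iff_of_nonneg (by positivity)).2 fun i => (h _ φ hφ).trans ?_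
    gcongr
    exact Finset.single_le_sum (f := fun i => C (Module.finBasis ℂ g i)) (fun i _ => hC _)
      (Finset.mem_univ i)
  have hlt' : (1 + ∑ i, C (Module.finBasis ℂ g i)) * ‖matrixCoord g k φ‖ < 1 := by
    rwa [← lt_inv_mul_iff₀ (by positivity), mul_one]
  have h0 : ‖matrixCoord g k φ‖ = 0 := by
    by_contra hne
    have hpos := (norm_nonneg (matrixCoord g k φ)).lt_of_ne' hne
    nlinarith
  refine (Module.finBasis ℂ g).ext fun i => (coord k).injective ?_
  rw [← matrixCoord_apply, norm_eq_zero.1 h0]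
  simp

end Isolated

/-! ### Homomorphisms that vanish on the Levi factor -/

section Levi

variable {s g h k : Type*} [LieRing s] [LieAlgebra ℂ s] [LieRing g] [LieAlgebra ℂ g]
  [LieRing h] [LieAlgebra ℂ h] [LieRing k] [LieAlgebra ℂ k]

/-- Restriction of linear maps along the inclusion `g → h`. -/
def restrictRight (α : g →ₗ⁅ℂ⁆ LieDerivation ℂ s s) (e : (s ⋊⁅α⁆ g) ≃ₗ⁅ℂ⁆ h)
    (k : Type*) [LieRing k] [LieAlgebra ℂ k] : (h →ₗ[ℂ] k) →ₗ[ℂ] (g →ₗ[ℂ] k) :=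
  LinearMap.lcomp ℂ k (e.toLinearEquiv.toLinearMap ∘ₗ
    (LieAlgebra.SemiDirectSum.inr α : g →ₗ[ℂ] (s ⋊⁅α⁆ g)))

/-- Restriction of linear maps along `STilde α → s → h`, for a linear map `σ : STilde α → s`. -/
def restrictLeft (α : g →ₗ⁅ℂ⁆ LieDerivation ℂ s s) (e : (s ⋊⁅α⁆ g) ≃ₗ⁅ℂ⁆ h)
    (k : Type*) [LieRing k] [LieAlgebra ℂ k] (σ : STilde α →ₗ[ℂ] s) :
    (h →ₗ[ℂ] k) →ₗ[ℂ] (STilde α →ₗ[ℂ] k) :=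
  LinearMap.lcomp ℂ k (e.toLinearEquiv.toLinearMap ∘ₗ
    (LieAlgebra.SemiDirectSum.inl α : s →ₗ[ℂ] (s ⋊⁅α⁆ g)) ∘ₗ σ)

variable (α : g →ₗ⁅ℂ⁆ LieDerivation ℂ s s) (e : (s ⋊⁅α⁆ g) ≃ₗ⁅ℂ⁆ h)

theorem restrictRight_apply (ψ : h →ₗ[ℂ] k) (y : g) :
    restrictRight α e k ψ y = ψ (e (LieAlgebra.SemiDirectSum.inr α y)) := rfl

theorem restrictLeft_apply (σ : STilde α →ₗ[ℂ] s) (ψ : h →ₗ[ℂ] k) (x : STilde α) :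
    restrictLeft α e k σ ψ x = ψ (e (LieAlgebra.SemiDirectSum.inl α (σ x))) := rfl

theorem restrictRight_mem_rep {ψ : h →ₗ[ℂ] k} (hψ : ψ ∈ rep h k) :
    restrictRight α e k ψ ∈ rep g k := fun x y => by
  simp only [restrictRight_apply]
  rw [LieHom.map_lie, LieEquiv.map_lie, hψ]

/-- The linear map `h → k` underlying `mapQ` depends linearly on the homomorphism. -/
def mapQLinear (k : Type*) [LieRing k] [LieAlgebra ℂ k] :
    (STilde α →ₗ[ℂ] k) →ₗ[ℂ] (h →ₗ[ℂ] k) :=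
  LinearMap.lcomp ℂ k (quotMap α ∘ₗ LieAlgebra.SemiDirectSum.projl α ∘ₗ
      (e.symm.toLinearEquiv : h →ₗ[ℂ] (s ⋊⁅α⁆ g)))

theorem mapQLinear_coe (Φ : rep (STilde α) k) :
    mapQLinear α e k (Φ : STilde α →ₗ[ℂ] k) = (mapQ α e k Φ : h →ₗ[ℂ] k) := rfl

theorem exists_quotMap_section : ∃ σ : STilde α →ₗ[ℂ] s, ∀ x, quotMap α (σ x) = x := by
  have hs : LinearMap.range (quotMap α) = ⊤ :=
    LinearMap.range_eq_top.2 (LieSubmodule.Quotient.surjective_mk' (actionIdeal α))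
  obtain ⟨σ, hσ⟩ := (quotMap α).exists_rightInverse_of_surjective hs
  exact ⟨σ, fun x => LinearMap.congr_fun hσ x⟩

variable {α e}

theorem map_inl_eq_of_quotMap_eq {ψ : h →ₗ[ℂ] k} (hψ : ψ ∈ rep h k)
    (h0 : restrictRight α e k ψ = 0) {x x' : s} (hx : quotMap α x = quotMap α x') :
    ψ (e (LieAlgebra.SemiDirectSum.inl α x)) = ψ (e (LieAlgebra.SemiDirectSum.inl α x')) := by
  let f : s →ₗ⁅ℂ⁆ k :=
    { toLinearMap := ψ ∘ₗ e.toLinearEquiv.toLinearMap ∘ₗ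
        (LieAlgebra.SemiDirectSum.inl α : s →ₗ[ℂ] (s ⋊⁅α⁆ g))
      map_lie' := fun {a b} => by
        change ψ (e (LieAlgebra.SemiDirectSum.inl α ⁅a, b⁆)) = _
        rw [LieHom.map_lie, LieEquiv.map_lie, hψ]
        rfl }
  have hker : actionIdeal α ≤ f.ker := by
    refine LieSubmodule.lieSpan_le.2 ?_
    rintro _ ⟨y, a, rfl⟩
    have h1 : LieAlgebra.SemiDirectSum.inl α (α y a) =
        ⁅LieAlgebra.SemiDirectSum.inr α y, LieAlgebra.SemiDirectSum.inl α a⁆ := by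
      simp
    refine LieHom.mem_ker.2 ?_
    change ψ (e (LieAlgebra.SemiDirectSum.inl α (α y a))) = 0
    rw [h1, LieEquiv.map_lie, hψ, ← restrictRight_apply, h0]
    simp
  have hmem : x - x' ∈ actionIdeal α := by
    refine (LieSubmodule.Quotient.mk_eq_zero (N := actionIdeal α)).1 ?_
    change quotMap α (x - x') = 0
    rw [map_sub, hx, sub_self]
  have h2 : f (x - x') = 0 := LieHom.mem_ker.1 (hker hmem)
  rw [map_sub, sub_eq_zero] at h2
  exact h2

/-- The section `σ` is only linear, but `σ ⁅x, y⁆` and `⁅σ x, σ y⁆` have the same image in the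
quotient, and `ψ` cannot tell them apart. -/
theorem restrictLeft_mem_rep {σ : STilde α →ₗ[ℂ] s} (hσ : ∀ x, quotMap α (σ x) = x)
    {ψ : h →ₗ[ℂ] k} (hψ : ψ ∈ rep h k)
    (h0 : restrictRight α e k ψ = 0) : restrictLeft α e k σ ψ ∈ rep (STilde α) k := by
  intro x y
  simp only [restrictLeft_apply]
  rw [← hψ, ← LieEquiv.map_lie, ← LieHom.map_lie]
  refine map_inl_eq_of_quotMap_eq hψ h0 ?_
  rw [quotMap_lie, hσ, hσ, hσ]

theorem restrictLeft_mapQ {σ : STilde α →ₗ[ℂ] s} (hσ : ∀ x, quotMap α (σ x) = x)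
    (Φ : rep (STilde α) k) :
    restrictLeft α e k σ (mapQ α e k Φ : h →ₗ[ℂ] k) = Φ := by
  ext1 x
  rw [restrictLeft_apply, mapQ_inl, hσ]

theorem mapQLinear_restrictLeft {σ : STilde α →ₗ[ℂ] s} (hσ : ∀ x, quotMap α (σ x) = x)
    {ψ : h →ₗ[ℂ] k} (hψ : ψ ∈ rep h k)
    (h0 : restrictRight α e k ψ = 0) : mapQLinear α e k (restrictLeft α e k σ ψ) = ψ := by
  ext1 z
  obtain ⟨w, rfl⟩ := e.surjective z
  have hw : w = LieAlgebra.SemiDirectSum.inl α w.left + LieAlgebra.SemiDirectSum.inr α w.right := by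
    simp
  have hr : ψ (e (LieAlgebra.SemiDirectSum.inr α w.right)) = 0 := by
    rw [← restrictRight_apply, h0]; rfl
  have hl : mapQLinear α e k (restrictLeft α e k σ ψ) (e w) =
      ψ (e (LieAlgebra.SemiDirectSum.inl α (σ (quotMap α w.left)))) := by
    simp [mapQLinear, restrictLeft]
  change mapQLinear α e k (restrictLeft α e k σ ψ) (e w) = ψ (e w)
  rw [hl, map_inl_eq_of_quotMap_eq hψ h0 (hσ (quotMap α w.left))]
  conv_rhs => rw [hw, map_add, map_add, hr, add_zero]

end Levi

theorem eventually_restrictRight_eq_zero {s g h k : Type*}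
    [LieRing h] [LieAlgebra ℂ h] [FiniteDimensional ℂ h] [LieRing s] [LieAlgebra ℂ s]
    [LieRing g] [LieAlgebra ℂ g] [FiniteDimensional ℂ g] [LieAlgebra.IsSemisimple ℂ g]
    [LieRing k] [LieAlgebra ℂ k] [FiniteDimensional ℂ k]
    (α : g →ₗ⁅ℂ⁆ LieDerivation ℂ s s) (e : (s ⋊⁅α⁆ g) ≃ₗ⁅ℂ⁆ h) :
    ∀ᶠ ψ : rep h k in nhdsOn (zeroRep h k), restrictRight α e k (ψ : h →ₗ[ℂ] k) = 0 := by
  obtain ⟨δ, hδ, hiso⟩ := exists_forall_rep_eq_zero (k := k) (span_lie_eq_top_of_isSemisimple ℂ g)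
  have h1 : Tendsto (fun ψ : rep h k => (ψ : h →ₗ[ℂ] k)) (nhdsOn (zeroRep h k))
    (nhdsAt (zeroRep h k : h →ₗ[ℂ] k)) := tendsto_comap
  have h2 := (tendsto_linearMap_nhdsAt (matrixCoord g k ∘ₗ restrictRight α e k)
    (zeroRep h k : h →ₗ[ℂ] k)).comp h1
  have h3 : (matrixCoord g k ∘ₗ restrictRight α e k) (zeroRep h k : h →ₗ[ℂ] k) = 0 :=
    map_zero (matrixCoord g k ∘ₗ restrictRight α e k)
  rw [h3] at h2
  filter_upwards [h2 (Metric.ball_mem_nhds 0 hδ)] with ψ hψ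
  exact hiso _ (restrictRight_mem_rep α e ψ.2) (by simpa using hψ)

end LieRepGerm

/-- Here `h = s ⋊ g` is a Levi decomposition: `s` is solvable, `g` is semisimple and `e` identifies
the semidirect product, formed with the action `α` of `g` on `s` by derivations, with `h`. -/
theorem proposition4p7
    {h s g k : Type*}
    [LieRing h] [LieAlgebra ℂ h] [FiniteDimensional ℂ h]
    [LieRing s] [LieAlgebra ℂ s] [FiniteDimensional ℂ s] [LieAlgebra.IsSolvable s]
    [LieRing g] [LieAlgebra ℂ g] [FiniteDimensional ℂ g] [LieAlgebra.IsSemisimple ℂ g]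
    [LieRing k] [LieAlgebra ℂ k] [FiniteDimensional ℂ k]
    (α : g →ₗ⁅ℂ⁆ LieDerivation ℂ s s)
    (e : (LieAlgebra.SemiDirectSum s g α) ≃ₗ⁅ℂ⁆ h) :
    LieRepGerm.InducesGermIso (LieRepGerm.mapQ α e k)
      (LieRepGerm.zeroRep (LieRepGerm.STilde α) k) (LieRepGerm.zeroRep h k) := by
  classical
  obtain ⟨σ, hσ⟩ := LieRepGerm.exists_quotMap_section α
  have hev := LieRepGerm.eventually_restrictRight_eq_zero (k := k) α e
  have hzero : LieRepGerm.mapQ α e k (LieRepGerm.zeroRep (LieRepGerm.STilde α) k) =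
      LieRepGerm.zeroRep h k := Subtype.ext (LinearMap.zero_comp _)
  -- The restriction along `σ` is known to be a homomorphism only when `ψ` vanishes on `g`. The
  -- default value elsewhere is invisible to the germ at `0`.
  let G : LieRepGerm.rep h k → LieRepGerm.rep (LieRepGerm.STilde α) k := fun ψ =>
    if h0 : LieRepGerm.restrictRight α e k (ψ : h →ₗ[ℂ] k) = 0 then
      ⟨LieRepGerm.restrictLeft α e k σ ψ, LieRepGerm.restrictLeft_mem_rep hσ ψ.2 h0⟩
    else LieRepGerm.zeroRep _ k
  have hG : ∀ ψ : LieRepGerm.rep h k,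
      LieRepGerm.restrictRight α e k (ψ : h →ₗ[ℂ] k) = 0 →
        (G ψ : LieRepGerm.STilde α →ₗ[ℂ] k) = LieRepGerm.restrictLeft α e k σ ψ := by
    intro ψ h0
    simp only [G, dif_pos h0]
  have hGQ : ∀ Φ, G (LieRepGerm.mapQ α e k Φ) = Φ := fun Φ => Subtype.ext <| by
    rw [hG (LieRepGerm.mapQ α e k Φ) (LinearMap.ext fun y => LieRepGerm.mapQ_inr α e k Φ y),
      LieRepGerm.restrictLeft_mapQ hσ]
  refine ⟨hzero, LieRepGerm.isAnalyticGermMap_of_linearMap (LieRepGerm.mapQLinear α e k)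
    (Eventually.of_forall fun Φ => LieRepGerm.mapQLinear_coe α e Φ), G, ?_,
    LieRepGerm.isAnalyticGermMap_of_linearMap (LieRepGerm.restrictLeft α e k σ) ?_,
    Eventually.of_forall hGQ, ?_⟩
  · rw [← hzero, hGQ]
  · filter_upwards [hev] with ψ h0 using (hG ψ h0).symm
  · filter_upwards [hev] with ψ h0
    refine Subtype.ext ?_
    rw [← LieRepGerm.mapQLinear_coe, hG ψ h0, LieRepGerm.mapQLinear_restrictLeft hσ ψ.2 h0]
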